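/- **Setting.** Let $N\le M$. There are $N$ agents, double integrators $\dot{\mathbf p}_i=\mathbf v_i$, $\dot{\mathbf v}_i=\mathbf u_i$ in $\mathbb R^2$, and $M$ goals with polynomial trajectories $\mathbf p_k^*(t)=\sum_{l=0}^{\eta_k}\mathbf c_{k,l}t^l$ of degree $\eta_k\ge 2$ (so $\mathbf c_{k,\eta_k}\neq 0$). Let $h>0$. The neighborhood $\mathcal N_i(t)$ of agent $i$ consists of the agents at distance at most $h$ from it, $i$ included. *Energy.* For an agent with state $(\mathbf p_0,\mathbf v_0)$ at time $\tau$, a goal $k$ and a duration $T>0$, let $E_k(T)=\int_0^T\|\mathbf a s+\mathbf b\|^2ds$, where $\mathbf a=\frac{12}{T^3}(\mathbf p_0-\mathbf p_k^*(\tau+T))+\frac{6}{T^2}(\mathbf v_0+\dot{\mathbf p}_k^*(\tau+T))$ and $\mathbf b=-\frac{6}{T^2}(\mathbf p_0-\mathbf p_k^*(\tau+T))-\frac2T(2\mathbf v_0+\dot{\mathbf p}_k^*(\tau+T))$ give the minimum-energy control that brings the agent to the state of the goal at time $\tau+T$; if the agent already has the state of the goal, $T=0$ is allowed as well, with energy $0$.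 Let $E^*_{i,k}(\tau)$ be the infimum of $E_k(T)$ over $T$ for agent $i$; a duration that minimizes $E_k$ is called an optimal arrival time. *Assignment problem.* Each agent $j$ has a set $\mathcal B_j$ of banned goals. The assignment problem of agent $i$ at time $t$ is to minimize $\sum_{j\in\mathcal N_i(t)}\sum_k a_{jk}E^*_{j,k}(t)$ over binary $a_{jk}$ with $\sum_k a_{jk}=1$ for $j\in\mathcal N_i(t)$, $\sum_{j\in\mathcal N_i(t)}a_{jk}\le 1$ for every $k$, and $a_{jk}=0$ for $j\in\mathcal N_i(t)$, $k\in\mathcal B_j$. Agent $i$ prescribes itself the goal $k$ with $a_{ik}=1$ in some optimal solution (and no goal if there is none). *Scheme.* At time $0$ all $\mathcal B_i$ are empty and every agent solves its assignment problem. The competing agents of $i$ are its neighbors $j\ne i$ with the same prescribed goal as $i$. As soon as some agent has a competing agent, an update takes place, and it is repeated as long as there are competing agents. At each update the agents are compared by a priority indicator $\mathbb I_i(j)\in\{0,1\}$, $i\ne j$, that expresses a strict total ordering of the agents ($\mathbb I_i(j)=1$ if $i$ has priority over $j$; it may differ from one update to the next). Every agent $i$ with $\mathbb I_i(j)=0$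 for some competing agent $j$ is permanently banned from its current goal (the goal is added to $\mathcal B_i$), and then solves its assignment problem again. All other agents keep their goals and banned sets; those among them that have competing agents may be assigned to their goal anew. Whenever an agent is assigned (also anew) to a goal for which an optimal arrival time exists, it chooses an optimal arrival time, generates a trajectory of minimum energy $\frac12\int\|\mathbf u\|^2$, possibly under further path constraints, that attains the state of the goal at that time, follows it, and then stays with the goal, all this until it is assigned a goal again. **Theorem 1.** Consider any execution of this scheme. Suppose that $E^*_{i,k}(t_1)\ge E^*_{i,k}(t_2)$ whenever agent $i$ is assigned to goal $k$ at times $t_1<t_2$. Then only finitely many updates take place, the finally prescribed goals of the $N$ agents are pairwise distinct, and there is a finite time from which on every agent has the position and velocity of its finally prescribed goal. -/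

import Mathlib

namespace GoalAssignment

open scoped Classical

noncomputable section

/-- The plane `ℝ²` with its Euclidean norm. -/
abbrev Plane : Type := EuclideanSpace ℝ (Fin 2)

/-- The state of a double integrator: position and velocity. -/
@[ext]
structure State where
  pos : Plane
  vel : Plane

/-! ### Goals -/

/-- `M` goals moving along polynomial trajectories of degree at least two. -/
structure PolyGoals (M : ℕ) where
  deg : Fin M → ℕ
  coeff : Fin M → ℕ → Plane
  two_le_deg : ∀ k, 2 ≤ deg k
  lead_ne_zero : ∀ k, coeff k (deg k) ≠ 0

/-- Position of goal `k` at time `t`: the polynomial `∑ l ≤ deg k, t ^ l • c k l`. -/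
def PolyGoals.pos {M : ℕ} (G : PolyGoals M) (k : Fin M) (t : ℝ) : Plane :=
  ∑ l ∈ Finset.range (G.deg k + 1), t ^ l • G.coeff k l

/-- Velocity of goal `k` at time `t`. -/
def PolyGoals.vel {M : ℕ} (G : PolyGoals M) (k : Fin M) (t : ℝ) : Plane :=
  deriv (G.pos k) t

/-- State (position and velocity) of goal `k` at time `t`. -/
def PolyGoals.state {M : ℕ} (G : PolyGoals M) (k : Fin M) (t : ℝ) : State :=
  ⟨G.pos k t, G.vel k t⟩

/-! ### Minimum energy and optimal arrival time -/

/-- Slope `a` of the minimum-energy control `u s = s • a + b` that steers the state `x₀` to the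
state `x₁` in time `T`. -/
def ctrlSlope (x₀ x₁ : State) (T : ℝ) : Plane :=
  (12 / T ^ 3) • (x₀.pos - x₁.pos) + (6 / T ^ 2) • (x₀.vel + x₁.vel)

/-- Intercept `b` of the minimum-energy control `u s = s • a + b` that steers the state `x₀` to
the state `x₁` in time `T`. -/
def ctrlIntercept (x₀ x₁ : State) (T : ℝ) : Plane :=
  -((6 / T ^ 2) • (x₀.pos - x₁.pos)) - (2 / T) • ((2 : ℝ) • x₀.vel + x₁.vel)

variable {M : ℕ}

/-- Energy `E(T) = ∫₀ᵀ ‖u(s)‖² ds` which an agent that is in state `x` at time `τ` needs in order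
to join goal `k` after the duration `T`, i.e. at time `τ + T`. -/
def energy (G : PolyGoals M) (k : Fin M) (τ : ℝ) (x : State) (T : ℝ) : ℝ :=
  ∫ s in (0 : ℝ)..T,
    ‖s • ctrlSlope x (G.state k (τ + T)) T + ctrlIntercept x (G.state k (τ + T)) T‖ ^ 2

/-- The durations after which the goal can be joined: every positive one, and also `0` for an
agent that is already at the goal and moves with it. -/
def arrivalTimes (G : PolyGoals M) (k : Fin M) (τ : ℝ) (x : State) : Set ℝ :=
  {T | 0 < T ∨ (T = 0 ∧ x = G.state k τ)}

/-- The minimum `E*` of the energy over the arrival time. It is an infimum here; that it is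
attained is not part of the definition. -/
def minEnergy (G : PolyGoals M) (k : Fin M) (τ : ℝ) (x : State) : ℝ :=
  sInf (energy G k τ x '' arrivalTimes G k τ x)

/-- `T` is a minimum-energy arrival time. -/
def IsOptimalArrival (G : PolyGoals M) (k : Fin M) (τ : ℝ) (x : State) (T : ℝ) : Prop :=
  T ∈ arrivalTimes G k τ x ∧ ∀ T' ∈ arrivalTimes G k τ x, energy G k τ x T ≤ energy G k τ x T'

/-! ### Trajectory generation -/

/-- `y` is a trajectory of the double integrator `ṗ = v`, `v̇ = u` on `[τ, τ + T]` from `x₀` to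
`x₁` with a control `u` of finite energy. -/
structure IsTransfer (τ T : ℝ) (x₀ x₁ : State) (y : ℝ → State) (u : ℝ → Plane) : Prop where
  integrable : IntervalIntegrable u MeasureTheory.volume τ (τ + T)
  finite_energy : IntervalIntegrable (fun s => ‖u s‖ ^ 2) MeasureTheory.volume τ (τ + T)
  vel_eq : ∀ t ∈ Set.Icc τ (τ + T), (y t).vel = x₀.vel + ∫ s in τ..t, u s
  pos_eq : ∀ t ∈ Set.Icc τ (τ + T), (y t).pos = x₀.pos + ∫ s in τ..t, (y s).vel
  final : y (τ + T) = x₁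

/-- `y` with control `u` minimizes the energy `½ ∫ ‖u‖²` among all trajectories from `x₀` to `x₁`
on `[τ, τ + T]` that satisfy the path constraints `K` (for instance bounds on speed and control,
or separation from other agents; `K = Set.univ` if there are none). -/
def IsOptimalTransfer (K : Set ((ℝ → State) × (ℝ → Plane))) (τ T : ℝ) (x₀ x₁ : State)
    (y : ℝ → State) (u : ℝ → Plane) : Prop :=
  IsTransfer τ T x₀ x₁ y u ∧ (y, u) ∈ K ∧
    ∀ y' u', IsTransfer τ T x₀ x₁ y' u' → (y', u') ∈ K →
      (1 / 2) * ∫ s in τ..(τ + T), ‖u s‖ ^ 2 ≤ (1 / 2) * ∫ s in τ..(τ + T), ‖u' s‖ ^ 2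

/-! ### Neighborhoods and the local assignment problem -/

variable {N : ℕ}

/-- The neighborhood of agent `i`: all agents within the sensing horizon `h`, `i` included. -/
def nbhd (h : ℝ) (x : Fin N → State) (i : Fin N) : Finset (Fin N) :=
  Finset.univ.filter fun j => dist (x i).pos (x j).pos ≤ h

/-- Feasibility in the assignment problem for the agents in `S` with banned goals `B`: a binary
matrix that assigns each agent of `S` to exactly one goal, each goal to at most one agent of `S`,
and no agent of `S` to one of its banned goals. Rows outside `S` play no role. -/
structure IsFeasible (S : Finset (Fin N)) (B : Fin N → Finset (Fin M))
    (a : Matrix (Fin N) (Fin M) ℕ) : Prop where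
  binary : ∀ j k, a j k = 0 ∨ a j k = 1
  row : ∀ j ∈ S, ∑ k, a j k = 1
  col : ∀ k, ∑ j ∈ S, a j k ≤ 1
  banned : ∀ j ∈ S, ∀ k ∈ B j, a j k = 0

/-- Total energy of an assignment of the agents in `S`, for energies `E j k`. -/
def cost (S : Finset (Fin N)) (E : Fin N → Fin M → ℝ) (a : Matrix (Fin N) (Fin M) ℕ) : ℝ :=
  ∑ j ∈ S, ∑ k, (a j k : ℝ) * E j k

/-- Optimal solutions of the assignment problem. -/
def IsOptimalAssignment (S : Finset (Fin N)) (B : Fin N → Finset (Fin M))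
    (E : Fin N → Fin M → ℝ) (a : Matrix (Fin N) (Fin M) ℕ) : Prop :=
  IsFeasible S B a ∧ ∀ a', IsFeasible S B a' → cost S E a ≤ cost S E a'

/-- `γ` is a goal which agent `i` may prescribe to itself at time `τ`, when the states are `x` and
the banned sets are `B`: the goal that some optimal solution of its assignment problem over its
neighborhood gives to `i`, or no goal at all if that problem has no solution. -/
def Prescribes (G : PolyGoals M) (h τ : ℝ) (x : Fin N → State) (B : Fin N → Finset (Fin M))
    (i : Fin N) (γ : Option (Fin M)) : Prop :=
  (∃ a k, IsOptimalAssignment (nbhd h x i) B (fun j l => minEnergy G l τ (x j)) a ∧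
      a i k = 1 ∧ γ = some k) ∨
  ((¬ ∃ a, IsOptimalAssignment (nbhd h x i) B (fun j l => minEnergy G l τ (x j)) a) ∧ γ = none)

/-! ### Competition and priority -/

/-- The agents competing with `i`: the other neighbors that have prescribed themselves the same
goal. -/
def competing (h : ℝ) (x : Fin N → State) (g : Fin N → Option (Fin M)) (i : Fin N) :
    Finset (Fin N) :=
  (nbhd h x i).filter fun j => j ≠ i ∧ ∃ k, g i = some k ∧ g j = some k

/-- A priority indicator: `I i j = true` says that `i` has priority over `j`. Exactly one of two
distinct agents has priority over the other, and priority is an ordering of the agents. -/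
structure IsPriority (I : Fin N → Fin N → Bool) : Prop where
  asymm : ∀ i j, i ≠ j → (I i j = true ↔ I j i = false)
  trans : ∀ i j k, i ≠ j → j ≠ k → i ≠ k → I i j = true → I j k = true → I i k = true

/-- Agent `i` competes with some agent over which it has no priority. -/
def Loses (h : ℝ) (x : Fin N → State) (g : Fin N → Option (Fin M)) (I : Fin N → Fin N → Bool)
    (i : Fin N) : Prop :=
  ∃ j ∈ competing h x g i, I i j = false

/-! ### Executions of the banning and reassignment scheme -/

/-- The data of an execution. Updates are numbered by `n = 0, 1, 2, …`, the initial assignment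
being update `0`; the goals `goal n` and banned sets `ban n` are those after update `n`, in force
until update `n + 1`. There need not be infinitely many updates: the entries for an `n` for which
`occurs n` fails have no meaning. -/
structure Run (N M : ℕ) where
  /-- the states of the agents as functions of time -/
  state : Fin N → ℝ → State
  /-- update `n` takes place -/
  occurs : ℕ → Prop
  /-- the time of update `n` -/
  time : ℕ → ℝ
  /-- the prescribed goals -/
  goal : ℕ → Fin N → Option (Fin M)
  /-- the banned goals -/
  ban : ℕ → Fin N → Finset (Fin M)
  /-- the agents which are assigned a goal and plan a trajectory to it at update `n` -/
  assigned : ℕ → Finset (Fin N)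
  /-- the priority indicator used at update `n` -/
  prio : ℕ → Fin N → Fin N → Bool
  /-- the path constraints that agent `i` takes into account when planning at update `n` -/
  constraints : ℕ → Fin N → Set ((ℝ → State) × (ℝ → Plane))

namespace Run

/-- Agent `i` is assigned to goal `k` at update `n`. -/
def AssignedTo (r : Run N M) (n : ℕ) (i : Fin N) (k : Fin M) : Prop :=
  r.occurs n ∧ i ∈ r.assigned n ∧ r.goal n i = some k

/-- The trajectory which agent `i` planned at update `n` is in force at time `t`: no later update
has replaced it before `t`. -/
def InForce (r : Run N M) (n : ℕ) (i : Fin N) (t : ℝ) : Prop :=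
  r.time n ≤ t ∧ ∀ m, n < m → r.occurs m → i ∈ r.assigned m → t ≤ r.time m

/-- The times, from update `n` on, at which some agent has a competitor under the goals
prescribed at update `n`. -/
def conflictTimes (r : Run N M) (h : ℝ) (n : ℕ) : Set ℝ :=
  {t | r.time n ≤ t ∧ ∃ i, (competing h (fun j => r.state j t) (r.goal n) i).Nonempty}

/-- Agent `i` loses a competition at the time of update `n + 1`. -/
def LosesAt (r : Run N M) (h : ℝ) (n : ℕ) (i : Fin N) : Prop :=
  Loses h (fun j => r.state j (r.time (n + 1))) (r.goal n) (r.prio (n + 1)) i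

/-- `r` is an execution of the banning and reassignment scheme. -/
structure IsExecution (r : Run N M) (G : PolyGoals M) (h : ℝ) : Prop where
  /-- Initially, at time `0`, nothing is banned and every agent prescribes itself a goal. -/
  occurs_zero : r.occurs 0
  time_zero : r.time 0 = 0
  ban_zero : ∀ i, r.ban 0 i = ∅
  assigned_zero : r.assigned 0 = Finset.univ
  goal_zero : ∀ i, Prescribes G h 0 (fun j => r.state j 0) (r.ban 0) i (r.goal 0 i)
  /-- The next update takes place as soon as some agent has a competitor, and only then. -/
  occurs_succ : ∀ n, r.occurs (n + 1) ↔ r.occurs n ∧ (r.conflictTimes h n).Nonempty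
  time_succ : ∀ n, r.occurs (n + 1) → IsLeast (r.conflictTimes h n) (r.time (n + 1))
  /-- At every update the agents are compared through a priority indicator. -/
  priority : ∀ n, r.occurs (n + 1) → IsPriority (r.prio (n + 1))
  /-- An agent that loses a competition is banned from its current goal, and solves its
  assignment problem again with the new banned sets. -/
  loser_ban : ∀ n i, r.occurs (n + 1) → r.LosesAt h n i →
    r.ban (n + 1) i = r.ban n i ∪ (r.goal n i).toFinset
  loser_goal : ∀ n i, r.occurs (n + 1) → r.LosesAt h n i →
    Prescribes G h (r.time (n + 1)) (fun j => r.state j (r.time (n + 1))) (r.ban (n + 1)) i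
      (r.goal (n + 1) i)
  loser_assigned : ∀ n i, r.occurs (n + 1) → r.LosesAt h n i → i ∈ r.assigned (n + 1)
  /-- All other agents keep their goals and banned sets; those among them which have competitors
  may be assigned to their goal anew, planning a new trajectory to it. -/
  keep_ban : ∀ n i, r.occurs (n + 1) → ¬ r.LosesAt h n i → r.ban (n + 1) i = r.ban n i
  keep_goal : ∀ n i, r.occurs (n + 1) → ¬ r.LosesAt h n i → r.goal (n + 1) i = r.goal n i
  assigned_subset : ∀ n i, r.occurs (n + 1) → i ∈ r.assigned (n + 1) →
    (competing h (fun j => r.state j (r.time (n + 1))) (r.goal n) i).Nonempty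
  /-- An agent that is assigned to a goal determines a minimum-energy arrival time, if there is
  one, generates an energy-optimal trajectory that joins the goal at that time, follows it, and
  then stays with the goal, all this until it is assigned a goal again. -/
  motion : ∀ n i k, r.AssignedTo n i k →
    (∃ T, IsOptimalArrival G k (r.time n) (r.state i (r.time n)) T) →
    ∃ T, IsOptimalArrival G k (r.time n) (r.state i (r.time n)) T ∧
      (∃ y u, IsOptimalTransfer (r.constraints n i) (r.time n) T (r.state i (r.time n))
          (G.state k (r.time n + T)) y u ∧
        ∀ t, r.InForce n i t → t ≤ r.time n + T → r.state i t = y t) ∧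
      ∀ t, r.InForce n i t → r.time n + T ≤ t → r.state i t = G.state k t

/-- The minimum energy of each agent for a goal does not increase from one assignment of the agent
to this goal to a later one. -/
def EnergyNonincreasing (r : Run N M) (G : PolyGoals M) : Prop :=
  ∀ i k m n, r.AssignedTo m i k → r.AssignedTo n i k → r.time m < r.time n →
    minEnergy G k (r.time n) (r.state i (r.time n)) ≤
      minEnergy G k (r.time m) (r.state i (r.time m))

end Run

end

end GoalAssignment

/-!
The energy of the minimum-energy transfer to a moving goal is coercive in the arrival time: it
blows up as `T → 0⁺` unless the agent is already with the goal, and as `T → ∞` because the velocity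
of the goal grows at least linearly. Hence optimal arrival times always exist, and an agent that is
never assigned again eventually moves with its goal.

The assignment problems never become infeasible. Among the agents that share a goal, the one with
the highest priority keeps it without being banned from it, so after every update each banned goal
is held by an agent that may keep it; giving these goals to such holders and distributing the other
goals, which nobody is banned from, among the remaining agents is a feasible assignment. Therefore
the loser of a competition always has a goal from which it is then newly banned, and at most `N * M`
updates take place. After the last one, two agents with the same goal would both end up in the state
of that goal and become competitors.
-/

namespace GoalAssignment

open Filter Topology Asymptotics

/-! ### Energy of the transfer to a moving goal -/

section PolynomialCurve

variable {E : Type*} [NormedAddCommGroup E] [NormedSpace ℝ E]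

theorem hasDerivAt_sum_range_pow_smul (c : ℕ → E) (n : ℕ) (t : ℝ) :
    HasDerivAt (fun t : ℝ => ∑ l ∈ Finset.range (n + 1), t ^ l • c l)
      (∑ l ∈ Finset.range n, t ^ l • ((l + 1 : ℝ) • c (l + 1))) t := by
  induction n with
  | zero => simpa using hasDerivAt_const t (c 0)
  | succ n ih =>
    simp only [Finset.sum_range_succ _ (n + 1)]
    rw [Finset.sum_range_succ _ n]
    refine ih.add (((hasDerivAt_pow (n + 1) t).smul_const (c (n + 1))).congr_deriv ?_)
    rw [smul_smul, mul_comm]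
    push_cast
    rfl

theorem isEquivalent_sum_range_pow_smul {c : ℕ → E} {n : ℕ} (hc : c n ≠ 0) :
    (fun t : ℝ => ∑ l ∈ Finset.range (n + 1), t ^ l • c l) ~[atTop] fun t => t ^ n • c n := by
  have hlower : (fun t : ℝ => ∑ l ∈ Finset.range n, t ^ l • c l) =o[atTop] fun t => t ^ n • c n :=
    .fun_sum fun l hl => (isLittleO_pow_pow_atTop_of_lt (Finset.mem_range.1 hl)).smul_isBigO
      (isBigO_const_const (c l) hc atTop)
  refine hlower.congr_left fun t => ?_
  simp [Finset.sum_range_succ]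

theorem isBigO_pow_sum_range_pow_smul {c : ℕ → E} {m n : ℕ} (hmn : m ≤ n) (hc : c n ≠ 0) :
    (fun t : ℝ => t ^ m) =O[atTop] fun t => ∑ l ∈ Finset.range (n + 1), t ^ l • c l := by
  have hpow : (fun t : ℝ => t ^ m) =O[atTop] fun t => t ^ n := by
    rcases hmn.eq_or_lt with rfl | hlt
    · exact isBigO_refl _ _
    · exact (isLittleO_pow_pow_atTop_of_lt hlt).isBigO
  have hlead : (fun t : ℝ => t ^ n) =O[atTop] fun t => t ^ n • c n := by
    simpa using (isBigO_refl (fun t : ℝ => t ^ n) atTop).smul (isBigO_const_const (1 : ℝ) hc atTop)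
  exact (hpow.trans hlead).trans (isEquivalent_sum_range_pow_smul hc).isBigO_symm

end PolynomialCurve

section Growth

variable {E : Type*} [NormedAddCommGroup E]

theorem isBigO_id_comp_const_add_sub_const {f : ℝ → E} (hf : (id : ℝ → ℝ) =O[atTop] f) (a : ℝ)
    (v : E) : (id : ℝ → ℝ) =O[atTop] fun t => f (a + t) - v := by
  have hshift : (id : ℝ → ℝ) =O[atTop] fun t => a + t :=
    (IsEquivalent.refl.const_add_of_norm_tendsto_atTop tendsto_norm_atTop_atTop).isBigO_symm
  have hfa : (id : ℝ → ℝ) =O[atTop] fun t => f (a + t) :=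
    hshift.trans (hf.comp_tendsto (tendsto_atTop_add_const_left _ a tendsto_id))
  have hv : (fun _ : ℝ => v) =o[atTop] fun t => f (a + t) :=
    (isLittleO_const_id_atTop v).trans_isBigO hfa
  exact hfa.trans hv.right_isBigO_sub

theorem tendsto_norm_sq_div_atTop {f : ℝ → E} (hf : (id : ℝ → ℝ) =O[atTop] f) :
    Tendsto (fun t => ‖f t‖ ^ 2 / t) atTop atTop := by
  obtain ⟨C, hC, hbound⟩ := hf.exists_pos
  refine tendsto_atTop_mono' _ ?_ (tendsto_id.atTop_div_const (pow_pos hC 2))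
  filter_upwards [hbound.bound, eventually_gt_atTop 0] with t ht ht0
  rw [id, Real.norm_of_nonneg ht0.le] at ht
  calc t / C ^ 2 = (t / C) ^ 2 / t := by field_simp
    _ ≤ ‖f t‖ ^ 2 / t := by
      gcongr
      exact (div_le_iff₀' hC).2 ht

theorem tendsto_norm_sq_div_pow_nhdsGT_zero {f : ℝ → E} (hf : ContinuousAt f 0) (hf0 : f 0 ≠ 0)
    {n : ℕ} (hn : n ≠ 0) : Tendsto (fun t => ‖f t‖ ^ 2 / t ^ n) (𝓝[>] 0) atTop := by
  have hpow : Tendsto (fun t : ℝ => (t⁻¹) ^ n) (𝓝[>] 0) atTop :=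
    (tendsto_pow_atTop hn).comp tendsto_inv_nhdsGT_zero
  have hnorm : Tendsto (fun t => ‖f t‖ ^ 2) (𝓝[>] 0) (𝓝 (‖f 0‖ ^ 2)) :=
    (hf.norm.pow 2).tendsto.mono_left nhdsWithin_le_nhds
  simpa only [inv_pow, ← div_eq_mul_inv] using hnorm.pos_mul_atTop (by positivity) hpow

end Growth

theorem exists_isMinOn_Ioi_of_tendsto_atTop {α : Type*} [LinearOrder α] [TopologicalSpace α]
    [ClosedIicTopology α] {f : ℝ → α} {a : ℝ} (hf : ContinuousOn f (Set.Ioi a))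
    (ha : Tendsto f (𝓝[>] a) atTop) (htop : Tendsto f atTop atTop) :
    ∃ T ∈ Set.Ioi a, IsMinOn f (Set.Ioi a) T := by
  let φ : ℝ → ℝ := fun s => a + Real.exp s
  have hφ : ∀ s, φ s ∈ Set.Ioi a := fun s => lt_add_of_pos_right a (Real.exp_pos s)
  have hbot : Tendsto φ atBot (𝓝[>] a) := by
    refine tendsto_nhdsWithin_iff.2 ⟨?_, .of_forall hφ⟩
    simpa only [add_zero] using Real.tendsto_exp_atBot.const_add a
  have hcont : Continuous (f ∘ φ) := hf.comp_continuous (by fun_prop) hφ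
  have hlim : Tendsto (f ∘ φ) (cocompact ℝ) atTop := by
    rw [cocompact_eq_atBot_atTop]
    exact (ha.comp hbot).sup (htop.comp (tendsto_atTop_add_const_left _ a Real.tendsto_exp_atTop))
  obtain ⟨s, hs⟩ := hcont.exists_forall_le hlim
  refine ⟨φ s, hφ s, isMinOn_iff.2 fun T hT => ?_⟩
  have hlog : φ (Real.log (T - a)) = T := by
    simp only [φ, Real.exp_log (sub_pos.2 hT), add_sub_cancel]
  simpa only [Function.comp_apply, hlog] using hs (Real.log (T - a))

theorem integral_norm_sub_half_smul_add_sq {E : Type*} [NormedAddCommGroup E]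
    [InnerProductSpace ℝ E] (a b : E) (T : ℝ) :
    ∫ s in (0 : ℝ)..T, ‖(s - T / 2) • a + b‖ ^ 2 = T ^ 3 / 12 * ‖a‖ ^ 2 + T * ‖b‖ ^ 2 := by
  have hderiv : ∀ s ∈ Set.uIcc 0 T, HasDerivAt
      (fun s : ℝ => (s - T / 2) ^ 3 / 3 * ‖a‖ ^ 2 + (s - T / 2) ^ 2 * inner ℝ a b + s * ‖b‖ ^ 2)
      (‖(s - T / 2) • a + b‖ ^ 2) s := by
    intro s _
    have hs : HasDerivAt (fun s : ℝ => s - T / 2) 1 s := (hasDerivAt_id s).sub_const _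
    have h := ((((hs.pow 3).div_const 3).mul_const (‖a‖ ^ 2)).add
      ((hs.pow 2).mul_const (inner ℝ a b))).add ((hasDerivAt_id s).mul_const (‖b‖ ^ 2))
    refine h.congr_deriv ?_
    rw [norm_add_sq_real, norm_smul, mul_pow, real_inner_smul_left, Real.norm_eq_abs, sq_abs]
    norm_num
    ring
  rw [intervalIntegral.integral_eq_sub_of_hasDerivAt hderiv
    (Continuous.intervalIntegrable (by fun_prop) _ _)]
  ring

/-- Twice the error, after the duration `T`, of the motion from `x₀` to `x₁` at the mean of the two
velocities (the trapezoidal rule): the control that joins the states has a slope proportional to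
it. -/
noncomputable def trapezoidDefect (x₀ x₁ : State) (T : ℝ) : Plane :=
  (2 : ℝ) • (x₀.pos - x₁.pos) + T • (x₀.vel + x₁.vel)

theorem smul_ctrlSlope_add_ctrlIntercept (x₀ x₁ : State) {T : ℝ} (hT : T ≠ 0) (s : ℝ) :
    s • ctrlSlope x₀ x₁ T + ctrlIntercept x₀ x₁ T =
      (s - T / 2) • ((6 / T ^ 3) • trapezoidDefect x₀ x₁ T) + T⁻¹ • (x₁.vel - x₀.vel) := by
  unfold ctrlSlope ctrlIntercept trapezoidDefect
  match_scalars <;> field_simp <;> ring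

theorem integral_norm_ctrl_sq (x₀ x₁ : State) {T : ℝ} (hT : T ≠ 0) :
    ∫ s in (0 : ℝ)..T, ‖s • ctrlSlope x₀ x₁ T + ctrlIntercept x₀ x₁ T‖ ^ 2 =
      3 * (‖trapezoidDefect x₀ x₁ T‖ ^ 2 / T ^ 3) + ‖x₁.vel - x₀.vel‖ ^ 2 / T := by
  simp only [smul_ctrlSlope_add_ctrlIntercept x₀ x₁ hT, integral_norm_sub_half_smul_add_sq,
    norm_smul, mul_pow, Real.norm_eq_abs, sq_abs]
  field_simp
  ring

section Energy

variable {M : ℕ} (G : PolyGoals M) (k : Fin M)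

theorem PolyGoals.vel_eq_sum (t : ℝ) :
    G.vel k t = ∑ l ∈ Finset.range (G.deg k), t ^ l • ((l + 1 : ℝ) • G.coeff k (l + 1)) :=
  (hasDerivAt_sum_range_pow_smul (G.coeff k) (G.deg k) t).deriv

theorem PolyGoals.continuous_pos : Continuous (G.pos k) := by
  unfold PolyGoals.pos
  fun_prop

theorem PolyGoals.continuous_vel : Continuous (G.vel k) := by
  simp only [funext (G.vel_eq_sum k)]
  fun_prop

theorem PolyGoals.isBigO_id_vel : (id : ℝ → ℝ) =O[atTop] G.vel k := by
  have hdeg := G.two_le_deg k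
  obtain ⟨n, hn⟩ : ∃ n, G.deg k = n + 1 := Nat.exists_eq_succ_of_ne_zero (by lia)
  have hlead : (n + 1 : ℝ) • G.coeff k (n + 1) ≠ 0 :=
    smul_ne_zero (by positivity) (hn ▸ G.lead_ne_zero k)
  have hn1 : 1 ≤ n := by lia
  simpa only [funext (G.vel_eq_sum k), hn, pow_one] using!
    isBigO_pow_sum_range_pow_smul (c := fun l => (l + 1 : ℝ) • G.coeff k (l + 1)) hn1 hlead

variable (τ : ℝ) (x : State)

theorem continuous_trapezoidDefect_state :
    Continuous fun T => trapezoidDefect x (G.state k (τ + T)) T := by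
  have hpos := G.continuous_pos k
  have hvel := G.continuous_vel k
  unfold trapezoidDefect PolyGoals.state
  fun_prop

theorem energy_eq {T : ℝ} (hT : T ≠ 0) :
    energy G k τ x T = 3 * (‖trapezoidDefect x (G.state k (τ + T)) T‖ ^ 2 / T ^ 3) +
      ‖G.vel k (τ + T) - x.vel‖ ^ 2 / T :=
  integral_norm_ctrl_sq x _ hT

theorem norm_trapezoidDefect_sq_div_le_energy {T : ℝ} (hT : 0 < T) :
    ‖trapezoidDefect x (G.state k (τ + T)) T‖ ^ 2 / T ^ 3 ≤ energy G k τ x T := by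
  have hpos : 0 ≤ ‖trapezoidDefect x (G.state k (τ + T)) T‖ ^ 2 / T ^ 3 := by positivity
  have hvel : 0 ≤ ‖G.vel k (τ + T) - x.vel‖ ^ 2 / T := by positivity
  linarith [energy_eq G k τ x hT.ne']

theorem norm_vel_sub_sq_div_le_energy {T : ℝ} (hT : 0 < T) :
    ‖G.vel k (τ + T) - x.vel‖ ^ 2 / T ≤ energy G k τ x T := by
  rw [energy_eq G k τ x hT.ne']
  exact le_add_of_nonneg_left (by positivity)

theorem continuousOn_energy : ContinuousOn (energy G k τ x) (Set.Ioi 0) := by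
  have hdefect := continuous_trapezoidDefect_state G k τ x
  have hvel := G.continuous_vel k
  refine ContinuousOn.congr ?_ fun T hT => energy_eq G k τ x (ne_of_gt hT)
  exact .add
    (.mul continuousOn_const (.div (hdefect.norm.pow 2).continuousOn (by fun_prop)
      fun T hT => pow_ne_zero 3 (ne_of_gt hT)))
    (.div (by fun_prop) (by fun_prop) fun T hT => ne_of_gt hT)

theorem tendsto_energy_atTop : Tendsto (energy G k τ x) atTop atTop := by
  refine tendsto_atTop_mono' _ ((eventually_gt_atTop 0).mono fun T hT =>
    norm_vel_sub_sq_div_le_energy G k τ x hT) ?_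
  exact tendsto_norm_sq_div_atTop
    (isBigO_id_comp_const_add_sub_const (G.isBigO_id_vel k) τ x.vel)

theorem tendsto_energy_nhdsGT_zero (hx : x ≠ G.state k τ) :
    Tendsto (energy G k τ x) (𝓝[>] 0) atTop := by
  have hvel := G.continuous_vel k
  by_cases hv : x.vel = G.vel k τ
  · have hp : x.pos - G.pos k τ ≠ 0 := fun hp => hx (State.ext (sub_eq_zero.1 hp) hv)
    refine tendsto_atTop_mono' _ (eventually_mem_nhdsWithin.mono fun T hT =>
      norm_trapezoidDefect_sq_div_le_energy G k τ x hT) ?_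
    exact tendsto_norm_sq_div_pow_nhdsGT_zero
      (continuous_trapezoidDefect_state G k τ x).continuousAt
      (by simpa [trapezoidDefect, PolyGoals.state] using hp) three_ne_zero
  · refine tendsto_atTop_mono' _ (eventually_mem_nhdsWithin.mono fun T hT =>
      norm_vel_sub_sq_div_le_energy G k τ x hT) ?_
    simpa only [pow_one] using tendsto_norm_sq_div_pow_nhdsGT_zero
      (f := fun T => G.vel k (τ + T) - x.vel) (by fun_prop)
      (by simpa [sub_eq_zero, eq_comm] using hv) one_ne_zero

theorem isOptimalArrival_zero (hx : x = G.state k τ) : IsOptimalArrival G k τ x 0 := by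
  refine ⟨Or.inr ⟨rfl, hx⟩, fun T hT => ?_⟩
  have hT0 : 0 ≤ T := hT.elim le_of_lt fun h => h.1.ge
  have hzero : energy G k τ x 0 = 0 := intervalIntegral.integral_same
  rw [hzero]
  exact intervalIntegral.integral_nonneg hT0 fun s _ => by positivity

theorem exists_isOptimalArrival : ∃ T, IsOptimalArrival G k τ x T := by
  by_cases hx : x = G.state k τ
  · exact ⟨0, isOptimalArrival_zero G k τ x hx⟩
  · obtain ⟨T, hT, hmin⟩ := exists_isMinOn_Ioi_of_tendsto_atTop (continuousOn_energy G k τ x)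
      (tendsto_energy_nhdsGT_zero G k τ x hx) (tendsto_energy_atTop G k τ x)
    exact ⟨T, Or.inl hT, fun T' hT' => hmin (hT'.resolve_right fun h => hx h.2)⟩

end Energy

/-! ### Solvability of the assignment problems -/

theorem exists_injective_forall_notMem {ι α : Type*} [Fintype ι] [Fintype α]
    (hcard : Fintype.card ι ≤ Fintype.card α) (B : ι → Finset α) (g : ι → α)
    (hB : ∀ j, ∀ k ∈ B j, ∃ i, g i = k ∧ k ∉ B i) :
    ∃ f : ι → α, Function.Injective f ∧ ∀ j, f j ∉ B j := by
  classical
  let K : Finset α := Finset.univ.biUnion B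
  have hK : ∀ {j k}, k ∈ B j → k ∈ K := fun {j k} hk =>
    Finset.mem_biUnion.2 ⟨j, Finset.mem_univ j, hk⟩
  have hsurj : Set.SurjOn g {i | g i ∉ B i} K := by
    intro k hk
    obtain ⟨j, -, hkj⟩ := Finset.mem_biUnion.1 hk
    obtain ⟨i, rfl, hi⟩ := hB j k hkj
    exact ⟨i, hi, rfl⟩
  have hKcard : K.card ≤ Fintype.card ι :=
    Finset.card_le_card_of_surjOn g (hsurj.mono (by simp) subset_rfl)
  obtain ⟨s, hs, hbij⟩ := hsurj.exists_bijOn_subset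
  obtain ⟨t, hKt, -, ht⟩ := Finset.exists_subsuperset_card_eq K.subset_univ hKcard hcard
  obtain ⟨e, he⟩ :=
    (hbij.mapsTo.mono_right hKt).exists_equiv_extend_of_card_eq ht.symm hbij.injOn
  refine ⟨fun i => e i, Subtype.val_injective.comp e.injective, fun j hj => ?_⟩
  obtain ⟨i, hi, hij⟩ := hbij.surjOn (hK hj)
  obtain rfl : i = j := e.injective (Subtype.ext ((he i hi).trans hij))
  exact hs hi (hij ▸ hj)

section Assignment

variable {N M : ℕ}

theorem isFeasible_of_injOn {S : Finset (Fin N)} {B : Fin N → Finset (Fin M)} {f : Fin N → Fin M}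
    (hf : Set.InjOn f S) (hfB : ∀ j ∈ S, f j ∉ B j) :
    IsFeasible S B fun j k => if f j = k then 1 else 0 where
  binary j k := by split_ifs <;> simp
  row j _ := by simp
  col k := by
    rw [← Finset.card_filter, Finset.card_le_one]
    intro a ha b hb
    obtain ⟨haS, rfl⟩ := Finset.mem_filter.1 ha
    obtain ⟨hbS, hba⟩ := Finset.mem_filter.1 hb
    exact hf haS hbS hba.symm
  banned j hj k hk := if_neg fun hjk : f j = k => hfB j hj (hjk ▸ hk)

theorem finite_setOf_isFeasible (S : Finset (Fin N)) (B : Fin N → Finset (Fin M)) :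
    {a | IsFeasible S B a}.Finite := by
  refine (Set.Finite.pi' fun _ : Fin N => Set.Finite.pi' fun _ : Fin M =>
    Set.toFinite ({0, 1} : Set ℕ)).subset fun a ha => ha.binary

theorem IsFeasible.exists_isOptimalAssignment {S : Finset (Fin N)} {B : Fin N → Finset (Fin M)}
    {a : Matrix (Fin N) (Fin M) ℕ} (ha : IsFeasible S B a) (E : Fin N → Fin M → ℝ) :
    ∃ a', IsOptimalAssignment S B E a' :=
  Set.exists_min_image _ (cost S E) (finite_setOf_isFeasible S B) ⟨a, ha⟩

theorem mem_nbhd_self {h : ℝ} (hh : 0 ≤ h) (x : Fin N → State) (i : Fin N) : i ∈ nbhd h x i := by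
  simp [nbhd, hh]

theorem Prescribes.exists_eq_some {G : PolyGoals M} {h τ : ℝ} {x : Fin N → State}
    {B : Fin N → Finset (Fin M)} {i : Fin N} {γ : Option (Fin M)} (hγ : Prescribes G h τ x B i γ)
    (hh : 0 ≤ h) {f : Fin N → Fin M} (hf : Function.Injective f) (hfB : ∀ j, f j ∉ B j) :
    ∃ k ∉ B i, γ = some k := by
  rcases hγ with ⟨a, k, ha, hak, rfl⟩ | ⟨hunsolvable, -⟩
  · refine ⟨k, fun hk => ?_, rfl⟩
    exact one_ne_zero (hak.symm.trans (ha.1.banned i (mem_nbhd_self hh x i) k hk))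
  · have hfeas := isFeasible_of_injOn (S := nbhd h x i) hf.injOn fun j _ => hfB j
    exact absurd (hfeas.exists_isOptimalAssignment _) hunsolvable

theorem mem_competing {h : ℝ} {x : Fin N → State} {g : Fin N → Option (Fin M)} {i j : Fin N} :
    j ∈ competing h x g i ↔
      dist (x i).pos (x j).pos ≤ h ∧ j ≠ i ∧ ∃ k, g i = some k ∧ g j = some k := by
  simp [competing, nbhd]

theorem mem_competing_comm {h : ℝ} {x : Fin N → State} {g : Fin N → Option (Fin M)}
    {i j : Fin N} : j ∈ competing h x g i ↔ i ∈ competing h x g j := by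
  simp only [mem_competing, dist_comm (x i).pos, ne_comm (a := i), and_comm (a := g i = _)]

theorem IsPriority.exists_forall_eq_true {I : Fin N → Fin N → Bool} (hI : IsPriority I)
    {s : Set (Fin N)} (hs : s.Nonempty) : ∃ m ∈ s, ∀ j ∈ s, j ≠ m → I m j = true := by
  let R : Fin N → Fin N → Prop := fun i j => i ≠ j ∧ I i j = true
  have hirrefl : Std.Irrefl R := ⟨fun i hi => hi.1 rfl⟩
  have htrans : IsTrans (Fin N) R := by
    refine ⟨fun i j k ⟨hij, hIij⟩ ⟨hjk, hIjk⟩ => ?_⟩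
    have hik : i ≠ k := by
      rintro rfl
      simp [(hI.asymm i j hij).1 hIij] at hIjk
    exact ⟨hik, hI.trans i j k hij hjk hik hIij hIjk⟩
  obtain ⟨m, hm, hmin⟩ := (Finite.wellFounded_of_trans_of_irrefl R).has_min s hs
  refine ⟨m, hm, fun j hj hjm => (hI.asymm m j hjm.symm).2 ?_⟩
  exact Bool.eq_false_iff.2 fun hIjm => hmin j hj ⟨hjm, hIjm⟩

theorem IsPriority.exists_not_loses {I : Fin N → Fin N → Bool} (hI : IsPriority I) (h : ℝ)
    (x : Fin N → State) {g : Fin N → Option (Fin M)} {i : Fin N} {k : Fin M} (hi : g i = some k) :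
    ∃ j, g j = some k ∧ ¬ Loses h x g I j := by
  obtain ⟨m, hm : g m = some k, hmax⟩ := hI.exists_forall_eq_true (s := {j | g j = some k}) ⟨i, hi⟩
  refine ⟨m, hm, fun ⟨j, hj, hmj⟩ => ?_⟩
  obtain ⟨-, hne, l, hml, hjl⟩ := mem_competing.1 hj
  have hjk : g j = some k := hjl.trans (hml.symm.trans hm)
  simp [hmax j hjk hne] at hmj

theorem IsPriority.exists_loses {I : Fin N → Fin N → Bool} (hI : IsPriority I) {h : ℝ}
    {x : Fin N → State} {g : Fin N → Option (Fin M)} {i : Fin N}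
    (hi : (competing h x g i).Nonempty) : ∃ j, Loses h x g I j := by
  obtain ⟨j, hj⟩ := hi
  have hne : i ≠ j := (mem_competing.1 hj).2.1.symm
  rcases hij : I i j with _ | _
  · exact ⟨i, j, hj, hij⟩
  · exact ⟨j, i, mem_competing_comm.1 hj, (hI.asymm i j hne).1 hij⟩

/-- Every agent has a goal from which it is not banned, and every banned goal is held by some agent.
This is the invariant of the scheme that keeps the assignment problems solvable. -/
structure IsConsistent (g : Fin N → Option (Fin M)) (B : Fin N → Finset (Fin M)) : Prop where
  exists_goal : ∀ i, ∃ k ∉ B i, g i = some k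
  exists_holder : ∀ j, ∀ k ∈ B j, ∃ i, g i = some k

end Assignment

/-! ### Executions -/

namespace Run.IsExecution

variable {N M : ℕ} {r : Run N M} {G : PolyGoals M} {h : ℝ}

theorem occurs_of_succ (hr : r.IsExecution G h) {n : ℕ} (hn : r.occurs (n + 1)) : r.occurs n :=
  ((hr.occurs_succ n).1 hn).1

theorem antitone_occurs (hr : r.IsExecution G h) : Antitone r.occurs :=
  antitone_nat_of_succ_le fun _ hn => hr.occurs_of_succ hn

theorem exists_keeper (hr : r.IsExecution G h) {n : ℕ} (hn : r.occurs (n + 1))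
    (hcons : IsConsistent (r.goal n) (r.ban n)) {j : Fin N} {k : Fin M}
    (hk : k ∈ r.ban (n + 1) j) :
    ∃ i, r.goal n i = some k ∧ r.goal (n + 1) i = some k ∧ k ∉ r.ban (n + 1) i := by
  obtain ⟨i₀, hi₀⟩ : ∃ i, r.goal n i = some k := by
    by_cases hlose : r.LosesAt h n j
    · rw [hr.loser_ban n j hn hlose, Finset.mem_union, Option.mem_toFinset] at hk
      exact hk.elim (hcons.exists_holder j k) fun hg => ⟨j, hg⟩
    · rw [hr.keep_ban n j hn hlose] at hk
      exact hcons.exists_holder j k hk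
  obtain ⟨i, hi, hkeep⟩ := (hr.priority n hn).exists_not_loses h
    (fun j => r.state j (r.time (n + 1))) hi₀
  refine ⟨i, hi, (hr.keep_goal n i hn hkeep).trans hi, ?_⟩
  obtain ⟨l, hl, hil⟩ := hcons.exists_goal i
  rwa [hr.keep_ban n i hn hkeep, Option.some_injective _ (hi.symm.trans hil)]

theorem exists_injective_notMem_ban_succ (hr : r.IsExecution G h) (hNM : N ≤ M) {n : ℕ}
    (hn : r.occurs (n + 1)) (hcons : IsConsistent (r.goal n) (r.ban n)) :
    ∃ f : Fin N → Fin M, Function.Injective f ∧ ∀ j, f j ∉ r.ban (n + 1) j := by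
  choose g _ hg using hcons.exists_goal
  refine exists_injective_forall_notMem (by simpa using hNM) _ g fun j k hk => ?_
  obtain ⟨i, hi, -, hkB⟩ := hr.exists_keeper hn hcons hk
  exact ⟨i, Option.some_injective _ ((hg i).symm.trans hi), hkB⟩

theorem isConsistent (hr : r.IsExecution G h) (hNM : N ≤ M) (hh : 0 ≤ h) {n : ℕ}
    (hn : r.occurs n) : IsConsistent (r.goal n) (r.ban n) := by
  induction n with
  | zero =>
    refine ⟨fun i => (hr.goal_zero i).exists_eq_some hh (Fin.castLE_injective hNM) ?_, ?_⟩ <;>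
      simp [hr.ban_zero]
  | succ n ih =>
    have hcons := ih (hr.occurs_of_succ hn)
    refine ⟨fun i => ?_, fun j k hk => (hr.exists_keeper hn hcons hk).imp fun _ hi => hi.2.1⟩
    by_cases hlose : r.LosesAt h n i
    · obtain ⟨f, hf, hfB⟩ := hr.exists_injective_notMem_ban_succ hNM hn hcons
      exact (hr.loser_goal n i hn hlose).exists_eq_some hh hf hfB
    · rw [hr.keep_goal n i hn hlose, hr.keep_ban n i hn hlose]
      exact hcons.exists_goal i

theorem ban_subset_ban_succ (hr : r.IsExecution G h) {n : ℕ} (hn : r.occurs (n + 1)) (i : Fin N) :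
    r.ban n i ⊆ r.ban (n + 1) i := by
  by_cases hlose : r.LosesAt h n i
  · exact hr.loser_ban n i hn hlose ▸ Finset.subset_union_left
  · exact (hr.keep_ban n i hn hlose).ge

theorem exists_ban_ssubset_ban_succ (hr : r.IsExecution G h) (hNM : N ≤ M) (hh : 0 ≤ h) {n : ℕ}
    (hn : r.occurs (n + 1)) : ∃ j, r.ban n j ⊂ r.ban (n + 1) j := by
  obtain ⟨i, hi⟩ := (hr.time_succ n hn).1.2
  obtain ⟨j, hj⟩ := (hr.priority n hn).exists_loses hi
  obtain ⟨k, hkB, hk⟩ := (hr.isConsistent hNM hh (hr.occurs_of_succ hn)).exists_goal j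
  refine ⟨j, (Finset.ssubset_iff_of_subset (hr.ban_subset_ban_succ hn j)).2 ⟨k, ?_, hkB⟩⟩
  simp [hr.loser_ban n j hn hj, hk]

theorem le_sum_card_ban (hr : r.IsExecution G h) (hNM : N ≤ M) (hh : 0 ≤ h) {n : ℕ}
    (hn : r.occurs n) : n ≤ ∑ i, (r.ban n i).card := by
  induction n with
  | zero => exact Nat.zero_le _
  | succ n ih =>
    obtain ⟨j, hj⟩ := hr.exists_ban_ssubset_ban_succ hNM hh hn
    calc n + 1 ≤ ∑ i, (r.ban n i).card + 1 := Nat.succ_le_succ (ih (hr.occurs_of_succ hn))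
      _ ≤ ∑ i, (r.ban (n + 1) i).card := Finset.sum_lt_sum
        (fun i _ => Finset.card_le_card (hr.ban_subset_ban_succ hn i))
        ⟨j, Finset.mem_univ j, Finset.card_lt_card hj⟩

theorem le_mul_of_occurs (hr : r.IsExecution G h) (hNM : N ≤ M) (hh : 0 ≤ h) {n : ℕ}
    (hn : r.occurs n) : n ≤ N * M := calc
  n ≤ ∑ i, (r.ban n i).card := hr.le_sum_card_ban hNM hh hn
  _ ≤ ∑ _i : Fin N, M := Finset.sum_le_sum fun i _ => card_finset_fin_le (r.ban n i)
  _ = N * M := by simp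

theorem exists_last_update (hr : r.IsExecution G h) (hNM : N ≤ M) (hh : 0 ≤ h) :
    ∃ n, r.occurs n ∧ ¬ r.occurs (n + 1) := by
  by_contra! hsucc
  have hall : ∀ n, r.occurs n := fun n => n.rec hr.occurs_zero hsucc
  exact (N * M).not_succ_le_self (hr.le_mul_of_occurs hNM hh (hall (N * M + 1)))

theorem exists_last_assignedTo (hr : r.IsExecution G h) {i : Fin N} {k : Fin M} {n : ℕ}
    (hn : r.occurs n) (hk : r.goal n i = some k) :
    ∃ m, r.AssignedTo m i k ∧ ∀ l, m < l → l ≤ n → i ∉ r.assigned l := by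
  induction n with
  | zero =>
    exact ⟨0, ⟨hn, by simp [hr.assigned_zero], hk⟩, fun l hpos hle => by lia⟩
  | succ n ih =>
    by_cases hi : i ∈ r.assigned (n + 1)
    · exact ⟨n + 1, ⟨hn, hi, hk⟩, fun l hlt hle => by lia⟩
    · have hkeep : ¬ r.LosesAt h n i := mt (hr.loser_assigned n i hn) hi
      obtain ⟨m, hm, hlast⟩ := ih (hr.occurs_of_succ hn) (hr.keep_goal n i hn hkeep ▸ hk)
      refine ⟨m, hm, fun l hml hln => ?_⟩
      rcases Nat.le_succ_iff.1 hln with hln | rfl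
      · exact hlast l hml hln
      · exact hi

theorem eventually_state_eq_of_assignedTo (hr : r.IsExecution G h) {m : ℕ} {i : Fin N} {k : Fin M}
    (hm : r.AssignedTo m i k) (hlast : ∀ l, m < l → r.occurs l → i ∉ r.assigned l) :
    ∀ᶠ t in atTop, r.state i t = G.state k t := by
  obtain ⟨T, -, -, hstay⟩ := hr.motion m i k hm (exists_isOptimalArrival G k _ _)
  filter_upwards [eventually_ge_atTop (r.time m), eventually_ge_atTop (r.time m + T)] with t ht htT
  exact hstay t ⟨ht, fun l hml hl hil => absurd hil (hlast l hml hl)⟩ htT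

theorem eventually_state_eq_of_last_update (hr : r.IsExecution G h) {n : ℕ} (hn : r.occurs n)
    (hlast : ¬ r.occurs (n + 1)) {i : Fin N} {k : Fin M} (hk : r.goal n i = some k) :
    ∀ᶠ t in atTop, r.state i t = G.state k t := by
  obtain ⟨m, hm, hfinal⟩ := hr.exists_last_assignedTo hn hk
  refine hr.eventually_state_eq_of_assignedTo hm fun l hml hl => hfinal l hml ?_
  exact not_lt.1 fun hnl => hlast (hr.antitone_occurs hnl hl)

theorem competing_eq_empty_of_last_update (hr : r.IsExecution G h) {n : ℕ} (hn : r.occurs n)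
    (hlast : ¬ r.occurs (n + 1)) {t : ℝ} (ht : r.time n ≤ t) (i : Fin N) :
    competing h (fun j => r.state j t) (r.goal n) i = ∅ := by
  by_contra hne
  exact hlast ((hr.occurs_succ n).2 ⟨hn, t, ht, i, Finset.nonempty_iff_ne_empty.2 hne⟩)

theorem injective_of_last_update (hr : r.IsExecution G h) (hh : 0 ≤ h) {n : ℕ} (hn : r.occurs n)
    (hlast : ¬ r.occurs (n + 1)) {t : ℝ} (ht : r.time n ≤ t) {g : Fin N → Fin M}
    (hg : ∀ i, r.goal n i = some (g i)) (hstate : ∀ i, r.state i t = G.state (g i) t) :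
    Function.Injective g := by
  intro i j hij
  by_contra hne
  have hdist : dist (r.state i t).pos (r.state j t).pos ≤ h := by
    simpa only [hstate, hij, dist_self] using hh
  have hcomp : j ∈ competing h (fun j => r.state j t) (r.goal n) i :=
    mem_competing.2 ⟨hdist, Ne.symm hne, g i, hg i, hij ▸ hg j⟩
  rw [hr.competing_eq_empty_of_last_update hn hlast ht i] at hcomp
  exact Finset.notMem_empty j hcomp

end Run.IsExecution

end GoalAssignment

theorem theorem1_general {N M : ℕ} (hNM : N ≤ M) (G : GoalAssignment.PolyGoals M) (h : ℝ)
    (hh : 0 ≤ h) (r : GoalAssignment.Run N M) (hr : r.IsExecution G h) :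
    ∃ (g : Fin N → Fin M) (n : ℕ) (Tf : ℝ),
      Function.Injective g ∧
      r.occurs n ∧ ¬ r.occurs (n + 1) ∧ (∀ i, r.goal n i = some (g i)) ∧
      r.time n ≤ Tf ∧ ∀ i, ∀ t, Tf ≤ t → r.state i t = G.state (g i) t := by
  obtain ⟨n, hn, hlast⟩ := hr.exists_last_update hNM hh
  choose g _ hg using (hr.isConsistent hNM hh hn).exists_goal
  have harrive : ∀ᶠ t in Filter.atTop, ∀ i, r.state i t = G.state (g i) t :=
    Filter.eventually_all.2 fun i => hr.eventually_state_eq_of_last_update hn hlast (hg i)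
  obtain ⟨Tf, hTf⟩ :=
    Filter.eventually_atTop.1 (harrive.and (Filter.eventually_ge_atTop (r.time n)))
  obtain ⟨hstate, hnTf⟩ := hTf Tf le_rfl
  exact ⟨g, n, Tf, hr.injective_of_last_update hh hn hlast hnTf hg hstate, hn, hlast, hg, hnTf,
    fun i t ht => (hTf t ht).1 i⟩

theorem theorem1 {N M : ℕ} (hNM : N ≤ M) (G : GoalAssignment.PolyGoals M) (h : ℝ) (hh : 0 < h)
    (r : GoalAssignment.Run N M) (hr : r.IsExecution G h) (hE : r.EnergyNonincreasing G) :
    ∃ (g : Fin N → Fin M) (n : ℕ) (Tf : ℝ),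
      Function.Injective g ∧
      r.occurs n ∧ ¬ r.occurs (n + 1) ∧ (∀ i, r.goal n i = some (g i)) ∧
      r.time n ≤ Tf ∧ ∀ i, ∀ t, Tf ≤ t → r.state i t = G.state (g i) t :=
  theorem1_general hNM G h hh.le r hr
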